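/- Theorem A. For commutative rings $R, S$, a ring homomorphism $\varphi\colon R\to S$ and $S$-modules $M,N$, let $\mathrm{Quad}_{\varphi}(M,N)$, also written $\mathrm{Quad}_{S/R}(M,N)$, denote the $S$-module of all maps $q\colon M\to N$ such that $q(sm)=s^2q(m)$ for all $s\in S$, $m\in M$, and such that the polarisation $(x,y)\mapsto q(x+y)-q(x)-q(y)$ is $R$-bilinear, where $R$ acts on $M$ and $N$ through $\varphi$. Write $\mathrm{Quad}_S(M,N)=\mathrm{Quad}_{\mathrm{id}_S}(M,N)$. Let $L/K$ be a field extension. Then $\mathrm{Quad}_{L/K}(M,N)=\mathrm{Quad}_L(M,N)$ for all $L$-vector spaces $M$ and $N$ if and only if the module of Kähler differentials $\Omega_{L/K}$ vanishes. Moreover: (1) if $\mathrm{char}(K)=p>0$, then $\Omega_{L/K}=0$ if and only if $L$ is generated as a field extension of $K$ by the $p$-th powers of its elements, that is, $L=K(L^p)$; (2) if $\mathrm{char}(K)=0$, then $\Omega_{L/K}=0$ if and only if $L/K$ is algebraic. -/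

import Mathlib

/-- For a homomorphism `φ : R → S` of commutative rings and `S`-modules `M`, `N`, the `S`-module
`Quad_φ(M, N)` of `φ`-quadratic maps: the maps `q : M → N` with `q (s m) = s² q m` for all `s : S`
whose polarisation `(x, y) ↦ q (x + y) - q x - q y` is `R`-bilinear, where `R` acts on `M` and `N`
through `φ`. The case `φ = RingHom.id S` gives the usual `S`-quadratic maps `Quad_S(M, N)`. -/
def Quad {R S : Type*} [CommRing R] [CommRing S] (φ : R →+* S) (M N : Type*)
    [AddCommGroup M] [Module S M] [AddCommGroup N] [Module S N] : Submodule S (M → N) where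
  carrier := {q |
    (∀ (s : S) (m : M), q (s • m) = s ^ 2 • q m) ∧
    (∀ x y z : M, QuadraticMap.polar q (x + y) z =
      QuadraticMap.polar q x z + QuadraticMap.polar q y z) ∧
    (∀ x y z : M, QuadraticMap.polar q x (y + z) =
      QuadraticMap.polar q x y + QuadraticMap.polar q x z) ∧
    (∀ (r : R) (x y : M), QuadraticMap.polar q (φ r • x) y = φ r • QuadraticMap.polar q x y) ∧
    (∀ (r : R) (x y : M), QuadraticMap.polar q x (φ r • y) = φ r • QuadraticMap.polar q x y)}
  zero_mem' := by simp [QuadraticMap.polar]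
  add_mem' := by
    rintro q q' ⟨h1, h2, h3, h4, h5⟩ ⟨k1, k2, k3, k4, k5⟩
    refine ⟨fun s m => ?_, fun x y z => ?_, fun x y z => ?_, fun r x y => ?_, fun r x y => ?_⟩
    · simp only [Pi.add_apply, h1, k1, smul_add]
    · simp only [QuadraticMap.polar_add, h2, k2]; abel
    · simp only [QuadraticMap.polar_add, h3, k3]; abel
    · simp only [QuadraticMap.polar_add, h4, k4, smul_add]
    · simp only [QuadraticMap.polar_add, h5, k5, smul_add]
  smul_mem' := by
    rintro c q ⟨h1, h2, h3, h4, h5⟩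
    refine ⟨fun s m => ?_, fun x y z => ?_, fun x y z => ?_, fun r x y => ?_, fun r x y => ?_⟩
    · simp only [Pi.smul_apply, h1, smul_comm c]
    · simp only [QuadraticMap.polar_smul, h2, smul_add]
    · simp only [QuadraticMap.polar_smul, h3, smul_add]
    · simp only [QuadraticMap.polar_smul, h4, smul_comm c]
    · simp only [QuadraticMap.polar_smul, h5, smul_comm c]

universe uK uL v w

open scoped IntermediateField

section Polar

variable {K L M N : Type*} [Field K] [Field L] [Algebra K L]
  [AddCommGroup M] [Module L M] [AddCommGroup N] [Module L N] {q : M → N}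

/-! Let `b` be the polarisation of `q`. When 2 is invertible, the defect `u ↦ b (u x, y) - u b (x,
y)` is a `K`-derivation of `L`, hence zero if `Ω[L⁄K]` vanishes. In characteristic 2, homogeneity
alone makes `b` linear over squares, and `Ω[L⁄K] = 0` forces `L = K(L²)`. Conversely `kaehlerQuad`
is always `K`-quadratic, but `L`-quadratic only if the universal derivation is zero. -/

theorem Quad.polar_smul_smul (h : q ∈ Quad (algebraMap K L) M N) (u : L) (x y : M) :
    QuadraticMap.polar q (u • x) (u • y) = u ^ 2 • QuadraticMap.polar q x y := by
  simp only [QuadraticMap.polar, ← smul_add, h.1, smul_sub]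

/-- This is the cross term of the homogeneity of `b` at the scalar `u + v`. -/
theorem Quad.polar_smul_add_polar_smul (h : q ∈ Quad (algebraMap K L) M N) (u v : L) (x y : M) :
    QuadraticMap.polar q (u • x) (v • y) + QuadraticMap.polar q (v • x) (u • y) =
      (2 * u * v) • QuadraticMap.polar q x y := by
  have h1 := Quad.polar_smul_smul h (u + v) x y
  simp only [add_smul, h.2.1, h.2.2.1, Quad.polar_smul_smul h] at h1
  rw [show (u + v) ^ 2 = u ^ 2 + 2 * u * v + v ^ 2 by ring, add_smul, add_smul] at h1
  have h2 : ∀ a b c d e : N, a + b + (c + d) = a + e + d → b + c = e := by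
    intro a b c d e h
    have : a + (b + c) + d = a + e + d := by rw [← h]; abel
    exact add_left_cancel (add_right_cancel this)
  exact h2 _ _ _ _ _ h1

/-- Twice the Leibniz rule for the defect. The mixed identity for `(v, 1)` at `u x` plus that for
`(u, 1)` at `v x` leaves a sum which the identity for `(u, v)` evaluates. -/
theorem Quad.two_smul_polar_mul_smul (h : q ∈ Quad (algebraMap K L) M N) (u v : L) (x y : M) :
    (2 : L) • QuadraticMap.polar q ((u * v) • x) y + (2 * u * v) • QuadraticMap.polar q x y =
      (2 * v) • QuadraticMap.polar q (u • x) y + (2 * u) • QuadraticMap.polar q (v • x) y := by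
  have h1 := Quad.polar_smul_add_polar_smul h v 1 (u • x) y
  have h2 := Quad.polar_smul_add_polar_smul h u 1 (v • x) y
  have h3 := Quad.polar_smul_add_polar_smul h u v x y
  simp only [one_smul, mul_one, one_mul, smul_smul] at h1 h2
  rw [← h1, ← h2, ← h3, mul_comm v u, two_smul]
  abel

/-- The failure of `L`-linearity of the polarisation in its first argument, as a derivation. -/
noncomputable def Quad.polarDerivation [Module K N] [IsScalarTower K L N] (h2 : (2 : L) ≠ 0)
    (h : q ∈ Quad (algebraMap K L) M N) (x y : M) : Derivation K L N :=
  Derivation.mk'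
    { toFun := fun u => QuadraticMap.polar q (u • x) y - u • QuadraticMap.polar q x y
      map_add' := fun u v => by simp only [add_smul, h.2.1]; abel
      map_smul' := fun k u => by
        rw [RingHom.id_apply, Algebra.smul_def, mul_smul, h.2.2.2.1, mul_smul, ← smul_sub,
          algebraMap_smul] }
    (fun u v => by
      apply smul_right_injective N h2
      have := Quad.two_smul_polar_mul_smul h u v x y
      have h' := eq_sub_of_add_eq this
      simp only [LinearMap.coe_mk, AddHom.coe_mk, smul_sub, smul_add, smul_smul, h']
      module)

theorem Quad.polar_smul_left_of_subsingleton_kaehler [Subsingleton (Ω[L⁄K])] (h2 : (2 : L) ≠ 0)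
    (h : q ∈ Quad (algebraMap K L) M N) (u : L) (x y : M) :
    QuadraticMap.polar q (u • x) y = u • QuadraticMap.polar q x y := by
  let : Module K N := Module.compHom N (algebraMap K L)
  have : IsScalarTower K L N := ⟨fun k l n => by
    rw [Algebra.smul_def, mul_smul]; rfl⟩
  have hd : Quad.polarDerivation h2 h x y = 0 := by
    rw [← (Quad.polarDerivation h2 h x y).liftKaehlerDifferential_comp]
    ext a
    simp [Subsingleton.elim (KaehlerDifferential.D K L a) 0]
  exact sub_eq_zero.mp (DFunLike.congr_fun hd u)

theorem Quad.polar_smul_left_of_adjoin_sq_eq_top (h2 : (2 : L) = 0)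
    (htop : IntermediateField.adjoin K (Set.range fun x : L => x ^ 2) = ⊤)
    (h : q ∈ Quad (algebraMap K L) M N) (u : L) (x y : M) :
    QuadraticMap.polar q (u • x) y = u • QuadraticMap.polar q x y := by
  have hu : u ∈ IntermediateField.adjoin K (Set.range fun x : L => x ^ 2) := htop ▸ trivial
  induction hu using IntermediateField.adjoin_induction generalizing x y with
  | mem u hu =>
    obtain ⟨w, rfl⟩ := hu
    -- With `2 = 0` this reads `b (w² x, y) + b (w x, w y) = 0`, and the second term is `w² b (x,
    -- y)`.
    have h1 := Quad.polar_smul_add_polar_smul h w 1 (w • x) y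
    simp only [h2, zero_mul, zero_smul, one_smul, one_mul, smul_smul, ← pow_two,
      Quad.polar_smul_smul h] at h1
    rw [eq_neg_of_add_eq_zero_left h1, ← neg_smul]
    congr 1
    linear_combination (-w ^ 2) * h2
  | algebraMap k => exact h.2.2.2.1 k x y
  | add a b _ _ ha hb => simp only [add_smul, h.2.1, ha, hb]
  | mul a b _ _ ha hb => rw [mul_smul, ha, hb, mul_smul]
  | inv a _ ha =>
    rcases eq_or_ne a 0 with rfl | h0
    · simpa using h.2.2.2.1 0 x y
    · rw [← (smul_right_injective N h0).eq_iff]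
      rw [← ha, smul_inv_smul₀ h0, smul_inv_smul₀ h0]

theorem Quad.mem_id_of_polar_smul_left (h : q ∈ Quad (algebraMap K L) M N)
    (hl : ∀ (u : L) (x y : M), QuadraticMap.polar q (u • x) y = u • QuadraticMap.polar q x y) :
    q ∈ Quad (RingHom.id L) M N :=
  ⟨h.1, h.2.1, h.2.2.1, hl, fun u x y => by
    rw [QuadraticMap.polar_comm, QuadraticMap.polar_comm q x]; exact hl u y x⟩

variable (K M N) in
theorem Quad.id_le_algebraMap : Quad (RingHom.id L) M N ≤ Quad (algebraMap K L) M N :=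
  fun _ h => ⟨h.1, h.2.1, h.2.2.1, fun k => h.2.2.2.1 (algebraMap K L k),
    fun k => h.2.2.2.2 (algebraMap K L k)⟩

end Polar

universe u₁ u₂ u₃ u₄

/-- The quadratic map `(s, t) ↦ s • D t - t • D s` attached to the universal derivation. -/
noncomputable def kaehlerQuad (K : Type u₁) (L : Type u₂) [Field K] [Field L] [Algebra K L] :
    ULift.{u₃} (L × L) → ULift.{u₄} (Ω[L⁄K]) := fun m =>
  ⟨m.down.1 • KaehlerDifferential.D K L m.down.2 - m.down.2 • KaehlerDifferential.D K L m.down.1⟩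

theorem polar_kaehlerQuad_down (K : Type u₁) (L : Type u₂) [Field K] [Field L] [Algebra K L]
    (x y : ULift.{u₃} (L × L)) :
    (QuadraticMap.polar (kaehlerQuad.{u₁, u₂, u₃, u₄} K L) x y).down =
      x.down.1 • KaehlerDifferential.D K L y.down.2 + y.down.1 • KaehlerDifferential.D K L x.down.2
      - x.down.2 • KaehlerDifferential.D K L y.down.1
      - y.down.2 • KaehlerDifferential.D K L x.down.1 := by
  simp only [QuadraticMap.polar, kaehlerQuad, ULift.sub_down, ULift.add_down, Prod.fst_add,
    Prod.snd_add, map_add]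
  module

/-- The `D s` terms in the value at `s • m` cancel by antisymmetry; bilinearity over `K` holds
because `D` kills `K`. -/
theorem kaehlerQuad_mem (K : Type u₁) (L : Type u₂) [Field K] [Field L] [Algebra K L] :
    kaehlerQuad.{u₁, u₂, u₃, u₄} K L ∈ Quad (algebraMap K L) (ULift.{u₃} (L × L))
      (ULift.{u₄} (Ω[L⁄K])) := by
  refine ⟨fun s m => ?_, fun x y z => ?_, fun x y z => ?_, fun r x y => ?_, fun r x y => ?_⟩ <;>
    apply ULift.down_injective
  · simp only [kaehlerQuad, ULift.smul_down, Prod.smul_fst, Prod.smul_snd, smul_eq_mul,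
      Derivation.leibniz]
    module
  all_goals
    simp only [polar_kaehlerQuad_down, ULift.add_down, ULift.smul_down, Prod.fst_add,
      Prod.snd_add, Prod.smul_fst, Prod.smul_snd, smul_eq_mul, Derivation.leibniz, map_add,
      Derivation.map_algebraMap]
    module

theorem subsingleton_kaehler_of_derivation_eq_zero {K L : Type*} [Field K] [Field L] [Algebra K L]
    (h : ∀ u, KaehlerDifferential.D K L u = 0) : Subsingleton (Ω[L⁄K]) := by
  have hs := KaehlerDifferential.span_range_derivation K L
  rw [← Submodule.subsingleton_iff L, ← subsingleton_iff_bot_eq_top, ← hs, eq_comm,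
    Submodule.span_eq_bot]
  rintro _ ⟨u, rfl⟩
  exact h u

theorem subsingleton_kaehler_of_kaehlerQuad_mem (K : Type u₁) (L : Type u₂) [Field K] [Field L]
    [Algebra K L] (h : kaehlerQuad.{u₁, u₂, u₃, u₄} K L ∈ Quad (RingHom.id L)
      (ULift.{u₃} (L × L)) (ULift.{u₄} (Ω[L⁄K]))) : Subsingleton (Ω[L⁄K]) := by
  refine subsingleton_kaehler_of_derivation_eq_zero fun u => ?_
  -- The polarisation is 0 at `(1, 0), (0, 1)` and `-D u` at `(u, 0), (0, 1)`.
  have := congrArg ULift.down (h.2.2.2.1 u ⟨(1, 0)⟩ ⟨(0, 1)⟩)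
  simpa [polar_kaehlerQuad_down] using this

section CharP

variable {K L : Type*} [Field K] [Field L] [Algebra K L]

theorem subsingleton_kaehler_of_adjoin_pow_eq_top (p : ℕ) [CharP L p]
    (h : IntermediateField.adjoin K (Set.range fun x : L => x ^ p) = ⊤) :
    Subsingleton (Ω[L⁄K]) := by
  refine subsingleton_kaehler_of_derivation_eq_zero fun u => ?_
  have hu : u ∈ IntermediateField.adjoin K (Set.range fun x : L => x ^ p) := h ▸ trivial
  induction hu using IntermediateField.adjoin_induction with
  | mem u hu =>
    obtain ⟨w, rfl⟩ := hu
    simp [Derivation.leibniz_pow, ← Nat.cast_smul_eq_nsmul L]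
  | algebraMap k => simp
  | add a b _ _ ha hb => simp [ha, hb]
  | mul a b _ _ ha hb => simp [ha, hb]
  | inv a _ ha => simp [Derivation.leibniz_inv, ha]

theorem IntermediateField.exists_maximal_notMem (F : IntermediateField K L) {x : L} (hx : x ∉ F) :
    ∃ E, F ≤ E ∧ Maximal (fun E : IntermediateField K L => x ∉ E) E := by
  refine zorn_le_nonempty₀ {E : IntermediateField K L | x ∉ E} (fun c hc hch E hE => ?_) F hx
  have : Nonempty c := ⟨⟨E, hE⟩⟩
  refine ⟨⨆ i : c, i.1, fun hmem => ?_, fun z hz => le_iSup (fun i : c => i.1) ⟨z, hz⟩⟩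
  rw [← SetLike.mem_coe, IntermediateField.coe_iSup_of_directed hch.directed] at hmem
  obtain ⟨i, hi⟩ := Set.mem_iUnion.mp hmem
  exact hc i.2 hi

theorem finrank_adjoin_simple_of_pow_mem_range (p : ℕ) [Fact p.Prime] [CharP L p] {y : L}
    {a : K} (ha : algebraMap K L a = y ^ p) (hy : y ∉ (algebraMap K L).range) :
    Module.finrank K K⟮y⟯ = p := by
  have hp : p.Prime := Fact.out
  have hirr : Irreducible (Polynomial.X ^ p - Polynomial.C a) := by
    refine X_pow_sub_C_irreducible_of_prime hp fun b hb => hy ⟨b, ?_⟩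
    apply frobenius_inj L p
    simp only [frobenius_def, ← map_pow, hb, ha]
  have hint : IsIntegral K y :=
    ⟨_, Polynomial.monic_X_pow_sub_C a hp.ne_zero, by simp [ha]⟩
  rw [IntermediateField.adjoin.finrank hint, ← minpoly.eq_of_irreducible_of_monic hirr
    (by simp [ha]) (Polynomial.monic_X_pow_sub_C a hp.ne_zero), Polynomial.natDegree_X_pow_sub_C]

/-- Otherwise take `E ⊇ K(L^p)` maximal among fields omitting some `x`. For `y ∉ E`, `E(y)` contains
`x` and has the same degree `p` as `E(x)`, so `L = E(x)`. This finite extension is purely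
inseparable and formally unramified, hence trivial, although `x ∉ E`. -/
theorem adjoin_pow_eq_top_of_subsingleton_kaehler (p : ℕ) [Fact p.Prime] [CharP L p]
    [Subsingleton (Ω[L⁄K])] :
    IntermediateField.adjoin K (Set.range fun x : L => x ^ p) = ⊤ := by
  have hp : p.Prime := Fact.out
  by_contra hne
  obtain ⟨x, -, hx⟩ := SetLike.exists_of_lt (lt_top_iff_ne_top.mpr hne)
  obtain ⟨E, hFE, hE⟩ := IntermediateField.exists_maximal_notMem _ hx
  have hpow (y : L) : y ^ p ∈ E :=
    hFE (IntermediateField.subset_adjoin K _ ⟨y, rfl⟩)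
  have hrange {y : L} : y ∈ (algebraMap E L).range ↔ y ∈ E :=
    ⟨fun ⟨e, he⟩ => he ▸ e.2, fun h => ⟨⟨y, h⟩, rfl⟩⟩
  have hrank {y : L} (hy : y ∉ E) : Module.finrank E E⟮y⟯ = p :=
    finrank_adjoin_simple_of_pow_mem_range p (a := ⟨y ^ p, hpow y⟩) rfl (mt hrange.mp hy)
  have htop : E⟮x⟯ = ⊤ := by
    rw [eq_top_iff]
    intro y _
    by_cases hy : y ∈ E
    · exact (E⟮x⟯).algebraMap_mem ⟨y, hy⟩
    have hxy : x ∈ E⟮y⟯ := by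
      by_contra hxy
      have hle : E ≤ (E⟮y⟯).restrictScalars K := fun z hz => (E⟮y⟯).algebraMap_mem ⟨z, hz⟩
      exact hy (hE.2 (y := (E⟮y⟯).restrictScalars K) hxy hle
        (IntermediateField.mem_adjoin_simple_self E y))
    have : FiniteDimensional E E⟮y⟯ :=
      Module.finite_of_finrank_pos (by rw [hrank hy]; exact hp.pos)
    have : E⟮x⟯ = E⟮y⟯ := IntermediateField.eq_of_le_of_finrank_eq
      (IntermediateField.adjoin_simple_le_iff.mpr hxy) (by rw [hrank hE.1, hrank hy])
    rw [this]
    exact IntermediateField.mem_adjoin_simple_self E y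
  have : FiniteDimensional E L := by
    apply Module.finite_of_finrank_pos
    rw [← IntermediateField.finrank_top', ← htop, hrank hE.1]
    exact hp.pos
  have : Algebra.FormallyUnramified K L := ⟨inferInstance⟩
  have : Algebra.FormallyUnramified E L := .of_restrictScalars K E L
  have : CharP E p := (algebraMap E L).charP (algebraMap E L).injective p
  have : ExpChar E p := .prime hp
  have : IsPurelyInseparable E L :=
    (isPurelyInseparable_iff_pow_mem E p).mpr fun y => ⟨1, by
      rw [pow_one]; exact hrange.mpr (hpow y)⟩
  have := Algebra.FormallyUnramified.range_eq_top_of_isPurelyInseparable E L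
  exact hE.1 (hrange.mp (this ▸ trivial))

end CharP

section CharZero

variable (K L : Type*) [Field K] [Field L] [Algebra K L] [CharZero K]

theorem subsingleton_kaehler_of_isAlgebraic [Algebra.IsAlgebraic K L] :
    Subsingleton (Ω[L⁄K]) :=
  have := Algebra.FormallyUnramified.of_isSeparable K L
  inferInstance

open TensorProduct in
-- `L` is formally étale over the polynomial ring `A` on a transcendence basis: localise, then use
-- that algebraic extensions are separable in characteristic 0. So the `dX i` give an `L`-basis of
-- `L ⊗[A] Ω[A⁄K] ≃ Ω[L⁄K]`, and the index set must be empty.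
theorem isAlgebraic_of_subsingleton_kaehler [Subsingleton (Ω[L⁄K])] :
    Algebra.IsAlgebraic K L := by
  obtain ⟨ι, x, hx⟩ := exists_isTranscendenceBasis' K L
  let A := MvPolynomial ι K
  let φ : A →ₐ[K] L := MvPolynomial.aeval x
  let : Algebra A L := φ.toAlgebra
  have : IsScalarTower K A L := .of_algebraMap_eq' φ.comp_algebraMap.symm
  have : FaithfulSMul A L := (faithfulSMul_iff_algebraMap_injective A L).mpr hx.1
  let : Algebra (FractionRing A) L := FractionRing.liftAlgebra A L
  have : Algebra.IsAlgebraic A L :=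
    hx.isAlgebraic_iff.mpr fun i => by
      rw [← MvPolynomial.aeval_X (R := K) x i]
      exact isAlgebraic_algebraMap (MvPolynomial.X i : A)
  have : Algebra.IsAlgebraic (FractionRing A) L :=
    (IsFractionRing.comap_isAlgebraic_iff (A := A) (K := FractionRing A) (C := L)).mp inferInstance
  have : CharZero (FractionRing A) := charZero_of_injective_algebraMap
    (algebraMap K (FractionRing A)).injective
  have : Algebra.FormallyEtale (FractionRing A) L := .of_isSeparable _ _
  have : Algebra.FormallyEtale A (FractionRing A) := .of_isLocalization (nonZeroDivisors A)
  have : Algebra.FormallyEtale A L := .comp A (FractionRing A) L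
  have : Subsingleton (L ⊗[A] Ω[A⁄K]) :=
    (KaehlerDifferential.tensorKaehlerEquivOfFormallyEtale K A L).subsingleton
  let b := (KaehlerDifferential.mvPolynomialBasis K ι).baseChange L
  have : IsEmpty ι := ⟨fun i => b.ne_zero i (Subsingleton.elim _ _)⟩
  exact hx.isEmpty_iff_isAlgebraic.mp inferInstance

end CharZero

theorem theoremA (K : Type uK) (L : Type uL) [Field K] [Field L] [Algebra K L] :
    ((∀ (M : Type (max uL v)) (N : Type (max uL w))
        [AddCommGroup M] [Module L M] [AddCommGroup N] [Module L N],
        Quad (algebraMap K L) M N = Quad (RingHom.id L) M N) ↔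
      Subsingleton (Ω[L⁄K])) ∧
    (∀ p : ℕ, 0 < p → CharP K p →
      (Subsingleton (Ω[L⁄K]) ↔
        IntermediateField.adjoin K (Set.range fun x : L => x ^ p) = ⊤)) ∧
    (CharZero K → (Subsingleton (Ω[L⁄K]) ↔ Algebra.IsAlgebraic K L)) := by
  refine ⟨⟨fun h => ?_, fun h M N _ _ _ _ => ?_⟩, fun p hp _ => ?_, fun _ => ?_⟩
  · refine subsingleton_kaehler_of_kaehlerQuad_mem.{uK, uL, v, w} K L ?_
    rw [← h]
    exact kaehlerQuad_mem K L
  · refine le_antisymm (fun q hq => Quad.mem_id_of_polar_smul_left hq ?_)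
      (Quad.id_le_algebraMap K M N)
    by_cases h2 : (2 : L) = 0
    · have : Fact (Nat.Prime 2) := ⟨Nat.prime_two⟩
      have : CharP L 2 := CharTwo.of_one_ne_zero_of_two_eq_zero one_ne_zero h2
      exact Quad.polar_smul_left_of_adjoin_sq_eq_top h2
        (adjoin_pow_eq_top_of_subsingleton_kaehler 2) hq
    · exact Quad.polar_smul_left_of_subsingleton_kaehler h2 hq
  · have : Fact p.Prime := ⟨(CharP.char_is_prime_or_zero K p).resolve_right hp.ne'⟩
    have : CharP L p := charP_of_injective_algebraMap (algebraMap K L).injective p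
    exact ⟨fun _ => adjoin_pow_eq_top_of_subsingleton_kaehler p,
      subsingleton_kaehler_of_adjoin_pow_eq_top p⟩
  · exact ⟨fun _ => isAlgebraic_of_subsingleton_kaehler K L,
      fun _ => subsingleton_kaehler_of_isAlgebraic K L⟩
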